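/- All graphs are undirected and simple, possibly infinite, and are viewed as structures with one binary relation $E$. **Definitions.** * A graph $M$ *has a stable edge relation* if there is $k\in\mathbb N$ such that there are no vertices $a_1,\dots,a_k,b_1,\dots,b_k$ of $M$ with $E(a_i,b_j)\iff i\le j$ for all $1\le i,j\le k$. * The *$r$-subdivision* of a graph is obtained by replacing each edge by a path of length $r+1$. A *unary expansion* of $M$ is a structure $\widehat M$ obtained from $M$ by adding unary predicates. For a first-order formula $\varphi(x,y)$, $\varphi(\widehat M)$ is the graph on the vertices of $M$ in which distinct $u,v$ are adjacent iff $\widehat M\models\varphi(u,v)\vee\varphi(v,u)$. The graph $M$ is *pattern-free* if for every $r\ge 1$, every class $\widehat{\mathcal C}$ of unary expansions of $M$ (in a common signature) and every quantifier-free formula $\varphi(x,y)$ in that signature, there is $n\ge1$ such that for no $\widehat M\in\widehat{\mathcal C}$ does $\varphi(\widehat M)$ contain the $r$-subdivision of the complete graph $K_n$ as an induced subgraph. * Let $S$ be a set of vertices of a graph $N$. Two vertices of $N$ are in the same *$S$-class* if they are equal, or if both lie outside of $S$ and have the same neighbours in $S$. The *flip* between vertex sets $A$ and $B$ complements the adjacency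 of all pairs of distinct vertices $u,v$ with $(u,v)\in (A\times B)\cup(B\times A)$. An *$S$-flip* of $N$ is a graph obtained from $N$ by finitely many flips between pairs $A,B$ (possibly $A=B$) of $S$-classes of $N$. * Vertex sets $A$ and $B$ of $N$ are *$r$-separated over $S$* in $N$ if there is an $S$-flip $H$ of $N$ such that $\operatorname{dist}_H(a,b)>r$ for all $a\in A$ and $b\in B$ (the distance being $\infty$ if there is no path). * A graph $M$ is *$r$-separable* if for every elementary extension $N$ of $M$ and every vertex $v\in N\setminus M$ there is a finite set $S\subseteq M$ such that $\{v\}$ and the vertex set of $M$ are $r$-separated over $S$ in $N$. **Theorem.** Let $M$ be a pattern-free graph with a stable edge relation. Then $M$ is $r$-separable for every $r\in\mathbb N$. -/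

import Mathlib

open FirstOrder

universe u w

namespace StableSep

/-! ### Graphs with a stable edge relation -/

/-- The edge relation of `M` is stable: for some `k` there is no ladder of length `k`, i.e. there
are no vertices `a₁, …, a_k, b₁, …, b_k` such that `a_i b_j` is an edge if and only if `i ≤ j`. -/
def HasStableEdgeRelation {V : Type*} (M : SimpleGraph V) : Prop :=
  ∃ k : ℕ, ¬ ∃ a b : Fin k → V, ∀ i j : Fin k, M.Adj (a i) (b j) ↔ i ≤ j

/-! ### Subdivisions -/

/-- The vertices of the `r`-subdivision of `G`: the vertices of `G`, and `r` new vertices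
`(e, 0), …, (e, r - 1)` for every edge `e` of `G`. The edge with endpoints `u < v` is represented
by the pair `(u, v)`. -/
abbrev SubdivVertex {V : Type*} [LinearOrder V] (G : SimpleGraph V) (r : ℕ) : Type _ :=
  V ⊕ ({e : V × V // e.1 < e.2 ∧ G.Adj e.1 e.2} × Fin r)

/-- The `r`-subdivision of `G`: every edge `uv`, `u < v`, is replaced by the path
`u, (uv, 0), …, (uv, r - 1), v` of length `r + 1`. -/
def subdivision {V : Type*} [LinearOrder V] (G : SimpleGraph V) (r : ℕ) :
    SimpleGraph (SubdivVertex G r) :=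
  SimpleGraph.fromRel fun x y =>
    match x, y with
    | .inl u, .inl v => r = 0 ∧ G.Adj u v
    | .inl u, .inr (e, i) => (u = e.1.1 ∧ (i : ℕ) = 0) ∨ (u = e.1.2 ∧ (i : ℕ) + 1 = r)
    | .inr (e, i), .inr (e', j) => e = e' ∧ (i : ℕ) + 1 = j
    | .inr _, .inl _ => False

/-! ### Unary expansions and pattern-free graphs -/

/-- The unary relation symbols indexed by `P`. -/
inductive UnaryRel (P : Type) : ℕ → Type
  | pred (p : P) : UnaryRel P 1

/-- The signature consisting of the unary relation symbols indexed by `P`. -/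
def unaryLang (P : Type) : FirstOrder.Language.{0, 0} := ⟨fun _ => Empty, UnaryRel P⟩

/-- The structure on `V` in which the predicate `p` is interpreted as the set `c p`. -/
@[reducible]
def unaryStructure {V : Type*} {P : Type} (c : P → Set V) : (unaryLang P).Structure V where
  funMap := fun f => Empty.elim f
  RelMap | .pred p => fun x => x 0 ∈ c p

/-- The signature of graphs (one binary relation symbol) together with unary relation symbols
indexed by `P`. -/
abbrev coloredGraphLang (P : Type) : FirstOrder.Language.{0, 0} :=
  FirstOrder.Language.graph.sum (unaryLang P)

/-- The unary expansion of the graph `M` in which the predicate `p` is interpreted as the set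
`c p`. -/
@[reducible]
def unaryExpansion {V : Type*} (M : SimpleGraph V) {P : Type} (c : P → Set V) :
    (coloredGraphLang P).Structure V :=
  letI := M.structure
  letI := unaryStructure c
  FirstOrder.Language.sumStructure FirstOrder.Language.graph (unaryLang P) V

/-- The graph `φ(M̂)`, for `M̂` the unary expansion of `M` by `c`: its vertices are those of `M`,
and distinct `u, v` are adjacent if and only if `M̂ ⊨ φ(u, v) ∨ φ(v, u)`. -/
def definedGraph {V : Type*} (M : SimpleGraph V) {P : Type} (c : P → Set V)
    (φ : (coloredGraphLang P).Formula (Fin 2)) : SimpleGraph V :=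
  letI := unaryExpansion M c
  SimpleGraph.fromRel fun u v => φ.Realize ![u, v]

/-- `M` is pattern-free: for every `r ≥ 1`, every class `C` of unary expansions of `M` by
predicates from a set `P`, and every quantifier-free formula `φ(x, y)` in the signature of these
expansions, there is `n ≥ 1` such that no graph `φ(M̂)`, with `M̂` in the class, contains the
`r`-subdivision of the complete graph `K_n` as an induced subgraph. -/
def PatternFree {V : Type*} (M : SimpleGraph V) : Prop :=
  ∀ r : ℕ, 1 ≤ r → ∀ (P : Type) (C : Set (P → Set V)) (φ : (coloredGraphLang P).Formula (Fin 2)),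
    φ.IsQF → ∃ n : ℕ, 1 ≤ n ∧ ∀ c ∈ C,
      IsEmpty (subdivision (⊤ : SimpleGraph (Fin n)) r ↪g definedGraph M c φ)

/-! ### Flips and separation -/

/-- The atomic flip specified by `(A, B)`: the adjacency of distinct vertices `u, v` is
complemented if `(u, v) ∈ (A × B) ∪ (B × A)`, and kept otherwise. -/
def atomicFlip {V : Type*} (G : SimpleGraph V) (A B : Set V) : SimpleGraph V where
  Adj u v := u ≠ v ∧ Xor (G.Adj u v) ((u ∈ A ∧ v ∈ B) ∨ (u ∈ B ∧ v ∈ A))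
  symm := ⟨fun u v h => by
    refine ⟨h.1.symm, ?_⟩
    have h2 := h.2
    rw [G.adj_comm v u]
    rw [xor_def] at h2 ⊢
    tauto⟩
  loopless := ⟨fun _ h => h.1 rfl⟩

/-- `H` is obtained from `G` by applying finitely many atomic flips, each specified by a pair of
members of the family `F`. -/
def IsFamilyFlip {V : Type*} (F : Set (Set V)) (G H : SimpleGraph V) : Prop :=
  ∃ l : List (Set V × Set V), (∀ p ∈ l, p.1 ∈ F ∧ p.2 ∈ F) ∧
    H = l.foldl (fun G' p => atomicFlip G' p.1 p.2) G

/-- Two vertices are in the same `S`-class if they are equal, or if both are outside of `S` and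
they have the same neighbours in `S`. -/
def sameClass {V : Type*} (G : SimpleGraph V) (S : Set V) : Setoid V where
  r u v := u = v ∨ (u ∉ S ∧ v ∉ S ∧ ∀ s ∈ S, G.Adj u s ↔ G.Adj v s)
  iseqv := by
    refine ⟨fun _ => Or.inl rfl, ?_, ?_⟩
    · rintro u v (h | ⟨hu, hv, h⟩)
      · exact Or.inl h.symm
      · exact Or.inr ⟨hv, hu, fun s hs => (h s hs).symm⟩
    · rintro u v w (rfl | ⟨hu, hv, h⟩) (rfl | ⟨hv', hw, h'⟩)
      · exact Or.inl rfl
      · exact Or.inr ⟨hv', hw, h'⟩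
      · exact Or.inr ⟨hu, hv, h⟩
      · exact Or.inr ⟨hu, hw, fun s hs => (h s hs).trans (h' s hs)⟩

/-- `H` is an `S`-flip of `G`: it arises from `G` by finitely many flips between `S`-classes
of `G`. -/
def IsSFlip {V : Type*} (S : Set V) (G H : SimpleGraph V) : Prop :=
  IsFamilyFlip (sameClass G S).classes G H

/-- The sets `A` and `B` are `r`-separated over `S` in `G`: in some `S`-flip of `G`, every vertex
of `A` is at distance greater than `r` (possibly infinite) from every vertex of `B`. -/
def RSeparated {V : Type*} (G : SimpleGraph V) (r : ℕ) (S A B : Set V) : Prop :=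
  ∃ H : SimpleGraph V, IsSFlip S G H ∧ ∀ a ∈ A, ∀ b ∈ B, (r : ℕ∞) < H.edist a b

/-! ### Elementary extensions and separability -/

/-- The elementary embeddings of the graph `M` into the graph `N`. Each of them exhibits `N` as an
elementary extension of the graph induced by `N` on the range of the embedding, a copy of `M`. -/
abbrev GraphElementaryEmbedding {V W : Type*} (M : SimpleGraph V) (N : SimpleGraph W) : Type _ :=
  @FirstOrder.Language.ElementaryEmbedding Language.graph V W M.structure N.structure

/-- The range of an elementary embedding: the vertices of `M`, as vertices of `N`. -/
def vertexRange {V W : Type*} {M : SimpleGraph V} {N : SimpleGraph W}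
    (f : GraphElementaryEmbedding M N) : Set W :=
  letI := M.structure
  letI := N.structure
  Set.range f

/-- `M` is `r`-separable: for every elementary extension `N` of `M` and every vertex `v` of `N`
outside of `M`, there is a finite set `S` of vertices of `M` such that `v` and the vertex set
of `M` are `r`-separated over `S` in `N`. -/
def RSeparable {V : Type u} (M : SimpleGraph V) (r : ℕ) : Prop :=
  ∀ (W : Type w) (N : SimpleGraph W) (f : GraphElementaryEmbedding M N) (v : W),
    v ∉ vertexRange f →
      ∃ S : Set W, S.Finite ∧ S ⊆ vertexRange f ∧ RSeparated N r S {v} (vertexRange f)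

end StableSep

namespace StableSep

/-! ### Existential closedness of elementary subgraphs -/

/-! Write `A` for the vertices of `M` inside `N`. Elementarity enters only through
`ExistentiallyClosedIn`: a finite configuration in `N` can be copied into `A` while its points in
`A` stay fixed. This carries stability up to `N`. It also yields two classical facts: the
neighbourhood in `A` of each vertex of `N` is a union of `S`-classes of `A` for some finite `S ⊆ A`
(`exists_definesTrace`), and these definitions are symmetric (`adj_iff_of_definesTrace`).

The proof is by induction on `r`. Suppose that the ball of radius `r` around `v` in a flip `H` over
a finite `S` misses `A`, and consider the traces on `A` of the vertices of this ball.

If there are finitely many traces, a finite `S'` defines and distinguishes all of them. Flipping the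
pairs of classes that carry edges between ball and `A` removes these edges. Vertices with empty
trace are unaffected, so the inner balls do not grow and the radius `r + 1` is reached
(`exists_flip_of_finite_traces`).

If there are infinitely many, Ramsey's theorem and stability turn geodesics from `v` to vertices
with distinct traces, each prolonged into `A`, into a homogeneous spider (`exists_isSpider`).
Copying its legs repeatedly into `A`, with the feet fixed, gives arbitrarily large layered patterns
in `M` (`IsSpider.exists_isLayeredPattern`). These encode subdivided cliques, against
pattern-freeness (`PatternFree.false_of_layeredPattern`). -/

/-- Every finite configuration of vertices of `G` has a copy in `A` which fixes the vertices that
already belong to `A`. -/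
def ExistentiallyClosedIn {W : Type*} (G : SimpleGraph W) (A : Set W) : Prop :=
  ∀ Y : Set W, Y.Finite → ∃ g : W → W, (∀ w ∈ Y, g w ∈ A) ∧ (∀ w ∈ Y, w ∈ A → g w = w) ∧
    (∀ w ∈ Y, ∀ w' ∈ Y, g w = g w' → w = w') ∧
    ∀ w ∈ Y, ∀ w' ∈ Y, (G.Adj (g w) (g w') ↔ G.Adj w w')

/-- The quantifier-free diagram of `Y`, with the points of `Y` in the range as parameters, is an
existential formula true in `N`, hence in `M`. -/
theorem existentiallyClosedIn_vertexRange {V : Type u} {W : Type w} {M : SimpleGraph V}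
    {N : SimpleGraph W} (f : GraphElementaryEmbedding M N) :
    ExistentiallyClosedIn N (vertexRange f) := by
  classical
  intro Y hY
  let := M.structure
  let := N.structure
  have : Finite Y := hY
  let α := {w : Y // w.1 ∈ vertexRange f}
  have hpre : ∀ a : α, ∃ m : V, f m = a.1.1 := fun a => a.2
  choose m hm using hpre
  let v (z : α ⊕ Y) : Language.graph.Term (α ⊕ Y) := Language.Term.var z
  let adj (p q : Y) : Language.graph.Formula (α ⊕ Y) :=
    Language.Relations.formula₂ Language.adj (v (.inr p)) (v (.inr q))
  let lit (p : Y × Y) : Language.graph.Formula (α ⊕ Y) :=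
    (if N.Adj p.1 p.2 then adj p.1 p.2 else (adj p.1 p.2).not) ⊓
      (if p.1 = p.2 then ⊤ else ((v (.inr p.1)).equal (v (.inr p.2))).not)
  let φ : Language.graph.Formula (α ⊕ Y) :=
    Language.Formula.iInf lit ⊓
      Language.Formula.iInf fun a : α => (v (.inl a)).equal (v (.inr a.1))
  have hN : (φ.iExs Y).Realize (f ∘ m) := by
    rw [Language.Formula.realize_iExs]
    refine ⟨fun w => w.1, ?_⟩
    simp only [φ, Language.Formula.realize_inf, Language.Formula.realize_iInf]
    refine ⟨fun p => ?_, fun a => ?_⟩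
    · simp only [lit, adj, v, Language.Formula.realize_inf]
      constructor
      · split_ifs with h
        · rw [Language.Formula.realize_rel₂]
          exact h
        · rw [Language.Formula.realize_not, Language.Formula.realize_rel₂]
          exact h
      · split_ifs with h
        · simp
        · simpa [Language.Formula.realize_not, Subtype.ext_iff] using h
    · simp [v, hm]
  rw [f.map_formula, Language.Formula.realize_iExs] at hN
  obtain ⟨b, hb⟩ := hN
  simp only [φ, Language.Formula.realize_inf, Language.Formula.realize_iInf] at hb
  obtain ⟨hb1, hb2⟩ := hb
  have hadj : ∀ x y : V, N.Adj (f x) (f y) ↔ M.Adj x y := fun x y =>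
    f.map_rel Language.adj ![x, y]
  refine ⟨fun w => if h : w ∈ Y then f (b ⟨w, h⟩) else w, ?_, ?_, ?_, ?_⟩
  · intro w hw
    simp only [hw, dif_pos]
    exact ⟨_, rfl⟩
  · intro w hw hwA
    have := hb2 ⟨⟨w, hw⟩, hwA⟩
    simp only [v, Language.Formula.realize_equal, Language.Term.realize_var, Sum.elim_inl,
      Sum.elim_inr] at this
    simp only [hw, dif_pos]
    rw [← this, hm]
  · intro w hw w' hw' h
    simp only [hw, hw', dif_pos] at h
    by_contra hne
    have := (hb1 (⟨w, hw⟩, ⟨w', hw'⟩))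
    simp only [lit, adj, v, Language.Formula.realize_inf] at this
    have h2 := this.2
    rw [if_neg (by simpa using hne)] at h2
    simp only [Language.Formula.realize_not, Language.Formula.realize_equal,
      Language.Term.realize_var, Sum.elim_inr] at h2
    exact h2 (f.injective h)
  · intro w hw w' hw'
    simp only [hw, hw', dif_pos]
    have := (hb1 (⟨w, hw⟩, ⟨w', hw'⟩))
    simp only [lit, adj, v, Language.Formula.realize_inf] at this
    have h1 := this.1
    rw [hadj]
    split_ifs at h1 with h
    · simpa [h, Language.Formula.realize_rel₂, Language.Structure.RelMap] using h1
    · simpa [h, Language.Formula.realize_rel₂, Language.Formula.realize_not,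
        Language.Structure.RelMap] using h1

/-! ### Ramsey's theorem for pairs -/

/-- Along a nonprincipal ultrafilter each row `c i` has a limit colour `d i`, and `d` has a limit
colour `k`. Indices with `d i = k` are then picked greedily. -/
theorem exists_strictMono_homogeneous {κ : Type*} [Finite κ] (c : ℕ → ℕ → κ) :
    ∃ (g : ℕ → ℕ) (k : κ), StrictMono g ∧ ∀ i j, i < j → c (g i) (g j) = k := by
  classical
  let U : Ultrafilter ℕ := Filter.hyperfilter ℕ
  have hpig : ∀ d : ℕ → κ, ∃ k, ∀ᶠ j in (U : Filter ℕ), d j = k := by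
    intro d
    have := (Ultrafilter.eventually_exists_iff (f := U) (P := fun k j => d j = k)).1
      (Filter.Eventually.of_forall fun j => ⟨d j, rfl⟩)
    exact this
  choose d hd using fun i => hpig (c i)
  obtain ⟨k, hk⟩ := hpig d
  have hgt : ∀ i, ∀ᶠ j in (U : Filter ℕ), i < j := by
    intro i
    have : (U : Filter ℕ) ≤ Filter.atTop := Nat.hyperfilter_le_atTop
    exact this (Filter.eventually_gt_atTop i)
  obtain ⟨g, hg1, hg2⟩ := exists_seq_of_forall_finset_exists (fun i => d i = k)
    (fun i j => i < j ∧ c i j = k) (by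
      intro s hs
      have : ∀ᶠ j in (U : Filter ℕ), ∀ x ∈ s, x < j ∧ c x j = k := by
        rw [Filter.eventually_all_finset]
        intro x hx
        filter_upwards [hgt x, hd x] with j h1 h2
        exact ⟨h1, h2.trans (hs x hx)⟩
      exact (hk.and this).exists)
  exact ⟨g, k, fun i j h => (hg2 i j h).1, fun i j h => (hg2 i j h).2⟩

/-! ### Consequences of the stability of the edge relation -/

theorem HasStableEdgeRelation.of_existentiallyClosedIn {V W : Type*} {M : SimpleGraph V}
    {N : SimpleGraph W} (f : M ↪g N) (hcl : ExistentiallyClosedIn N (Set.range f))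
    (h : HasStableEdgeRelation M) : HasStableEdgeRelation N := by
  obtain ⟨k, hk⟩ := h
  refine ⟨k, fun ⟨a, b, hab⟩ => hk ?_⟩
  obtain ⟨g, hg, -, -, hadj⟩ := hcl (Set.range a ∪ Set.range b)
    ((Set.finite_range a).union (Set.finite_range b))
  choose a' ha' using fun i => hg (a i) (Or.inl ⟨i, rfl⟩)
  choose b' hb' using fun i => hg (b i) (Or.inr ⟨i, rfl⟩)
  refine ⟨a', b', fun i j => ?_⟩
  rw [← f.map_adj_iff, ha', hb', hadj _ (Or.inl ⟨i, rfl⟩) _ (Or.inr ⟨j, rfl⟩), hab]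

section Stable

variable {W : Type*} {G : SimpleGraph W}

theorem HasStableEdgeRelation.not_ladder (h : HasStableEdgeRelation G) (x y : ℕ → W)
    (h1 : ∀ i j, i < j → G.Adj (x i) (y j)) (h2 : ∀ i j, i < j → ¬ G.Adj (x j) (y i)) : False := by
  obtain ⟨k, hk⟩ := h
  -- Even and odd indices never coincide, so the unspecified diagonal is avoided and `i ≤ j` becomes
  -- a strict inequality.
  refine hk ⟨fun i => x (2 * i), fun j => y (2 * j + 1), fun i j => ?_⟩
  rw [Fin.le_def]
  constructor
  · intro hadj
    by_contra hlt
    exact h2 _ _ (by omega) hadj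
  · intro hle
    exact h1 _ _ (by omega)

/-- In a graph with stable edge relation, homogeneous sequences are symmetric. -/
theorem HasStableEdgeRelation.symm_of_homogeneous (h : HasStableEdgeRelation G) (x y : ℕ → W)
    (p q : Prop) (h1 : ∀ i j, i < j → (G.Adj (x i) (y j) ↔ p))
    (h2 : ∀ i j, i < j → (G.Adj (x j) (y i) ↔ q)) : p ↔ q := by
  by_cases hp : p <;> by_cases hq : q
  · exact iff_of_true hp hq
  · exact (h.not_ladder x y (fun i j hij => (h1 i j hij).2 hp)
      (fun i j hij => fun h' => hq ((h2 i j hij).1 h'))).elim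
  · exact (h.not_ladder y x (fun i j hij => ((h2 i j hij).2 hq).symm)
      (fun i j hij => fun h' => hp ((h1 i j hij).1 h'.symm))).elim
  · exact iff_of_false hp hq

/-- The trace of `w` on `A` is determined by the `S`-classes. -/
def DefinesTrace (G : SimpleGraph W) (A S : Set W) (w : W) : Prop :=
  ∀ m ∈ A, ∀ m' ∈ A, sameClass G S m m' → (G.Adj w m ↔ G.Adj w m')

theorem sameClass_mono {S S' : Set W} (hS : S ⊆ S') {x y : W} (h : sameClass G S' x y) :
    sameClass G S x y := by
  rcases h with h | ⟨h1, h2, h3⟩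
  · exact Or.inl h
  · exact Or.inr ⟨fun h => h1 (hS h), fun h => h2 (hS h), fun s hs => h3 s (hS hs)⟩

theorem DefinesTrace.mono {A S S' : Set W} {w : W} (h : DefinesTrace G A S w) (hS : S ⊆ S') :
    DefinesTrace G A S' w :=
  fun m hm m' hm' hs => h m hm m' hm' (sameClass_mono hS hs)

/-- Copies over `S` lie in the same `S`-class. -/
theorem sameClass_copy {A S Y : Set W} {g : W → W} (hSA : S ⊆ A) (hSY : S ⊆ Y)
    (hfix : ∀ w ∈ Y, w ∈ A → g w = w) (hinj : ∀ w ∈ Y, ∀ w' ∈ Y, g w = g w' → w = w')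
    (hadj : ∀ w ∈ Y, ∀ w' ∈ Y, (G.Adj (g w) (g w') ↔ G.Adj w w')) {w : W} (hw : w ∈ Y)
    (hwA : w ∉ A) : sameClass G S (g w) w := by
  refine Or.inr ⟨fun h => ?_, fun h => hwA (hSA h), fun s hs => ?_⟩
  · have := hinj _ hw _ (hSY h) (hfix _ (hSY h) (hSA h)).symm
    rw [← this] at h
    exact hwA (hSA h)
  · rw [← hadj _ hw _ (hSY hs), hfix s (hSY hs) (hSA hs)]

/-- If every finite `S` fails, one builds copies `a` of `w` and pairs `b`, `c` in one class over the
earlier data, with `w` adjacent to `b` only. Later `a` see earlier `b` but not earlier `c`, while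
earlier `a` cannot tell later `b` from later `c`. After Ramsey, stability forces contradictory
values. -/
theorem exists_definesTrace (hst : HasStableEdgeRelation G) {A : Set W}
    (hcl : ExistentiallyClosedIn G A) (w : W) :
    ∃ S : Set W, S.Finite ∧ S ⊆ A ∧ DefinesTrace G A S w := by
  classical
  by_contra hno
  push Not at hno
  obtain ⟨f, hf1, hf2⟩ := exists_seq_of_forall_finset_exists
    (fun t : W × W × W => (t.1 ∈ A ∧ t.2.1 ∈ A ∧ t.2.2 ∈ A) ∧ G.Adj w t.2.1 ∧ ¬ G.Adj w t.2.2)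
    (fun s t => G.Adj t.1 s.2.1 ∧ ¬ G.Adj t.1 s.2.2 ∧ (G.Adj s.1 t.2.1 ↔ G.Adj s.1 t.2.2)) (by
      intro s hs
      let S : Set W := (Prod.fst '' (s : Set (W × W × W))) ∪
        ((fun t => t.2.1) '' (s : Set (W × W × W)) ∪ (fun t => t.2.2) '' (s : Set (W × W × W)))
      have hSfin : S.Finite := (s.finite_toSet.image _).union
        ((s.finite_toSet.image _).union (s.finite_toSet.image _))
      have hSA : S ⊆ A := by
        rintro x (⟨t, ht, rfl⟩ | ⟨t, ht, rfl⟩ | ⟨t, ht, rfl⟩)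
        exacts [(hs t ht).1.1, (hs t ht).1.2.1, (hs t ht).1.2.2]
      obtain ⟨b, hb, c, hc, hbc, hwb, hwc⟩ : ∃ b ∈ A, ∃ c ∈ A, sameClass G S b c ∧
          G.Adj w b ∧ ¬ G.Adj w c := by
        have := hno S hSfin hSA
        simp only [DefinesTrace, not_forall] at this
        obtain ⟨m, hm, m', hm', hmm, hne⟩ := this
        by_cases h : G.Adj w m
        · exact ⟨m, hm, m', hm', hmm, h, fun h' => hne (iff_of_true h h')⟩
        · refine ⟨m', hm', m, hm, (sameClass G S).symm hmm, ?_, h⟩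
          by_contra h'
          exact hne (iff_of_false h h')
      obtain ⟨g, hgA, hfix, -, hadj⟩ := hcl (insert w S) (hSfin.insert w)
      have hadj' : ∀ x ∈ S, (G.Adj (g w) x ↔ G.Adj w x) := fun x hx => by
        rw [← hadj w (Or.inl rfl) x (Or.inr hx), hfix x (Or.inr hx) (hSA hx)]
      refine ⟨(g w, b, c), ⟨⟨hgA w (Or.inl rfl), hb, hc⟩, hwb, hwc⟩, fun x hx => ?_⟩
      have hx1 : x.1 ∈ S := Or.inl ⟨x, hx, rfl⟩
      have hx2 : x.2.1 ∈ S := Or.inr (Or.inl ⟨x, hx, rfl⟩)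
      have hx3 : x.2.2 ∈ S := Or.inr (Or.inr ⟨x, hx, rfl⟩)
      refine ⟨(hadj' _ hx2).2 (hs x hx).2.1, fun h => (hs x hx).2.2 ((hadj' _ hx3).1 h), ?_⟩
      rcases hbc with rfl | ⟨-, -, h⟩
      · rfl
      · have := h _ hx1
        rwa [G.adj_comm, G.adj_comm c] at this)
  obtain ⟨g, p, hg, hp⟩ := exists_strictMono_homogeneous fun i j => G.Adj (f i).1 (f j).2.1
  have h1 := hst.symm_of_homogeneous (fun i => (f (g i)).1) (fun i => (f (g i)).2.1) p True
    (fun i j hij => iff_of_eq (hp i j hij))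
    (fun i j hij => iff_true_intro (hf2 _ _ (hg hij)).1)
  have h2 := hst.symm_of_homogeneous (fun i => (f (g i)).1) (fun i => (f (g i)).2.2) p False
    (fun i j hij => (hf2 _ _ (hg hij)).2.2.symm.trans (iff_of_eq (hp i j hij)))
    (fun i j hij => iff_false_intro (hf2 _ _ (hg hij)).2.1)
  exact (h1.symm.trans h2).1 trivial

/-- Symmetry of definable traces (Harrington's lemma), in one direction. -/
theorem adj_of_definesTrace (hst : HasStableEdgeRelation G) {A S : Set W}
    (hcl : ExistentiallyClosedIn G A) (hSfin : S.Finite) (hSA : S ⊆ A) {u w m m' : W}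
    (hu : u ∉ A) (hw : w ∉ A) (hSu : DefinesTrace G A S u) (hSw : DefinesTrace G A S w)
    (hm : m ∈ A) (hm' : m' ∈ A) (hmu : sameClass G S m u) (hmw : sameClass G S m' w)
    (h : G.Adj w m) : G.Adj u m' := by
  classical
  by_contra hnot
  have key : ∀ z ∉ A, ∀ Z : Set W, Z.Finite → Z ⊆ A → ∃ z' ∈ A, sameClass G S z' z ∧
      ∀ x ∈ Z, (G.Adj z' x ↔ G.Adj z x) := by
    intro z hz Z hZ hZA
    obtain ⟨g, hgA, hfix, hinj, hadj⟩ := hcl (insert z (S ∪ Z)) ((hSfin.union hZ).insert z)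
    refine ⟨g z, hgA z (Or.inl rfl), sameClass_copy hSA (fun x hx => Or.inr (Or.inl hx)) hfix hinj
      hadj (Or.inl rfl) hz, fun x hx => ?_⟩
    rw [← hadj z (Or.inl rfl) x (Or.inr (Or.inr hx)), hfix x (Or.inr (Or.inr hx)) (hZA hx)]
  -- Alternating copies of `w` and `u` in `A`, each over the earlier ones, form a half graph.
  obtain ⟨f, -, hf2⟩ := exists_seq_of_forall_finset_exists
    (fun t : W × W => t.1 ∈ A ∧ t.2 ∈ A ∧ sameClass G S t.1 w ∧ sameClass G S t.2 u)
    (fun s t => G.Adj t.1 s.2 ∧ ¬ G.Adj s.1 t.2) (by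
      intro s hs
      obtain ⟨a, haA, haw, ha⟩ := key w hw (Prod.snd '' (s : Set (W × W))) (s.finite_toSet.image _)
        (by rintro x ⟨t, ht, rfl⟩; exact (hs t ht).2.1)
      obtain ⟨c, hcA, hcu, hc⟩ := key u hu (Prod.fst '' (s : Set (W × W))) (s.finite_toSet.image _)
        (by rintro x ⟨t, ht, rfl⟩; exact (hs t ht).1)
      refine ⟨(a, c), ⟨haA, hcA, haw, hcu⟩, fun x hx => ⟨?_, ?_⟩⟩
      · rw [ha _ ⟨x, hx, rfl⟩]
        exact (hSw _ hm _ (hs x hx).2.1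
          ((sameClass G S).trans hmu ((sameClass G S).symm (hs x hx).2.2.2))).1 h
      · rw [G.adj_comm, hc _ ⟨x, hx, rfl⟩]
        exact fun h' => hnot ((hSu _ hm' _ (hs x hx).1
          ((sameClass G S).trans hmw ((sameClass G S).symm (hs x hx).2.2.1))).2 h'))
  have := hst.symm_of_homogeneous (fun i => (f i).1) (fun i => (f i).2) False True
    (fun i j hij => iff_false_intro (hf2 _ _ hij).2)
    (fun i j hij => iff_true_intro (hf2 _ _ hij).1)
  exact this.2 trivial

theorem adj_iff_of_definesTrace (hst : HasStableEdgeRelation G) {A S : Set W}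
    (hcl : ExistentiallyClosedIn G A) (hSfin : S.Finite) (hSA : S ⊆ A) {u w m m' : W}
    (hu : u ∉ A) (hw : w ∉ A) (hSu : DefinesTrace G A S u) (hSw : DefinesTrace G A S w)
    (hm : m ∈ A) (hm' : m' ∈ A) (hmu : sameClass G S m u) (hmw : sameClass G S m' w) :
    G.Adj w m ↔ G.Adj u m' :=
  ⟨adj_of_definesTrace hst hcl hSfin hSA hu hw hSu hSw hm hm' hmu hmw,
    adj_of_definesTrace hst hcl hSfin hSA hw hu hSw hSu hm' hm hmw hmu⟩

end Stable
/-! ### Layered patterns -/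

/-- The formula saying that two vertices are adjacent. -/
def adjFormula : (coloredGraphLang ℕ).Formula (Fin 2) :=
  Language.Relations.formula₂ (show (coloredGraphLang ℕ).Relations 2 from Sum.inl Language.adj)
    (Language.Term.var 0) (Language.Term.var 1)

/-- The formula saying that the vertex with index `i` has colour `k`. -/
def colorFormula (k : ℕ) (i : Fin 2) : (coloredGraphLang ℕ).Formula (Fin 2) :=
  Language.Relations.formula₁
    (show (coloredGraphLang ℕ).Relations 1 from Sum.inr (UnaryRel.pred k)) (Language.Term.var i)

open Classical in
/-- The formula saying that, for some `l < n`, the first vertex has colour `l`, the second one has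
colour `l + 1`, and they are adjacent if and only if `ε l` holds. -/
noncomputable def layerFormula (ε : ℕ → Prop) : ℕ → (coloredGraphLang ℕ).Formula (Fin 2)
  | 0 => ⊥
  | n + 1 => layerFormula ε n ⊔ (colorFormula n 0 ⊓ colorFormula (n + 1) 1 ⊓
      if ε n then adjFormula else adjFormula.not)

theorem layerFormula_isQF (ε : ℕ → Prop) (n : ℕ) : (layerFormula ε n).IsQF := by
  induction n with
  | zero => exact Language.BoundedFormula.isQF_bot
  | succ n ih =>
    unfold layerFormula
    refine ih.sup (Language.BoundedFormula.IsQF.inf (Language.BoundedFormula.IsQF.inf ?_ ?_) ?_)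
    · exact (Language.BoundedFormula.IsAtomic.rel _ _).isQF
    · exact (Language.BoundedFormula.IsAtomic.rel _ _).isQF
    · split_ifs
      · exact (Language.BoundedFormula.IsAtomic.rel _ _).isQF
      · exact (Language.BoundedFormula.IsAtomic.rel _ _).isQF.not

theorem realize_layerFormula {V : Type*} (M : SimpleGraph V) (c : ℕ → Set V) (ε : ℕ → Prop) (n : ℕ)
    (x y : V) :
    letI := unaryExpansion M c
    (layerFormula ε n).Realize ![x, y] ↔ ∃ l < n, x ∈ c l ∧ y ∈ c (l + 1) ∧ (M.Adj x y ↔ ε l) := by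
  let := unaryExpansion M c
  induction n with
  | zero => simp [layerFormula, Language.Formula.Realize]
  | succ n ih =>
    change _ ↔ _ at ih
    have hE : adjFormula.Realize ![x, y] ↔ M.Adj x y := by
      rw [adjFormula, Language.Formula.realize_rel₂]
      exact Iff.rfl
    have hP : ∀ (k : ℕ) (i : Fin 2), (colorFormula k i).Realize ![x, y] ↔ ![x, y] i ∈ c k := by
      intro k i
      rw [colorFormula, Language.Formula.realize_rel₁]
      exact Iff.rfl
    rw [layerFormula, Language.Formula.realize_sup, Language.Formula.realize_inf,
      Language.Formula.realize_inf, hP, hP, ih]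
    have hlast : (open Classical in if ε n then adjFormula else adjFormula.not).Realize ![x, y] ↔
        (M.Adj x y ↔ ε n) := by
      split_ifs with h
      · rw [hE]; tauto
      · rw [Language.Formula.realize_not, hE]; tauto
    rw [hlast]
    simp only [Nat.lt_succ_iff_lt_or_eq, or_and_right, exists_or, exists_eq_left,
      Matrix.cons_val_zero, Matrix.cons_val_one, and_assoc]

/-- `q` is a layered pattern: the vertex `q a l i` is the vertex of level `l` on the `i`-th branch
in the `a`-th copy of a spider with legs of length `K`, whose feet of index `i` are joined, for all
copies, to the same vertex of level `K + 1`. Adjacency between the levels `l` and `l + 1` means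
that the adjacency in `G` agrees with `ε l`. -/
structure IsLayeredPattern {V : Type*} (G : SimpleGraph V) (K : ℕ) (ε : ℕ → Prop) (T : ℕ)
    (q : ℕ → ℕ → ℕ → V) : Prop where
  adj_iff : ∀ a b l i j, l ≤ K → i < T → j < T →
    ((G.Adj (q a l i) (q b (l + 1) j) ↔ ε l) ↔ (a = b ∨ l = K) ∧ (i = j ∨ l = 0))
  ne : ∀ a b l l' i j, l ≤ K + 1 → l' ≤ K + 1 → i < T → j < T → l ≠ l' → q a l i ≠ q b l' j

/-- A vertex is recognised by its pattern neighbours one level up and one level down. With `1 ≤ K`,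
the root level and the level of the feet are not consecutive, so the two tests together suffice. -/
theorem IsLayeredPattern.inj {V : Type*} {G : SimpleGraph V} {K T : ℕ} {ε : ℕ → Prop}
    {q : ℕ → ℕ → ℕ → V} (hq : IsLayeredPattern G K ε T q) (hK : 1 ≤ K) {a b l i j : ℕ}
    (hl : l ≤ K + 1) (hi : i < T) (hj : j < T) (h : q a l i = q b l j) :
    (a = b ∨ l = K + 1) ∧ (i = j ∨ l = 0) := by
  have up : l ≤ K → (a = b ∨ l = K) ∧ (i = j ∨ l = 0) := by
    intro hlK
    have h1 := (hq.adj_iff a a l i i hlK hi hi).2 ⟨Or.inl rfl, Or.inl rfl⟩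
    rw [h] at h1
    have := (hq.adj_iff b a l j i hlK hj hi).1 h1
    tauto
  have down : 1 ≤ l → (a = b ∨ l = K + 1) ∧ (i = j ∨ l = 1) := by
    intro hl1
    obtain ⟨l, rfl⟩ := Nat.exists_eq_add_of_le' hl1
    have h1 := (hq.adj_iff a a l i i (by omega) hi hi).2 ⟨Or.inl rfl, Or.inl rfl⟩
    rw [h] at h1
    have := (hq.adj_iff a b l i j (by omega) hi hj).1 h1
    simpa using this
  rcases Nat.lt_or_ge l 1 with h0 | h1
  · have := up (by omega)
    omega
  · have := down h1
    by_cases hlK : l ≤ K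
    · have := up hlK
      omega
    · omega

/-- The root of copy `a` is the principal vertex `a`. An edge `ab` runs along one leg of copy `a` to
the common foot and back along the same leg of copy `b`, through `2 * K + 1` inner vertices. Since
`K` and `ε` do not depend on `T`, a single formula serves all `n`. -/
theorem PatternFree.false_of_layeredPattern {V : Type*} {M : SimpleGraph V} (hM : PatternFree M)
    {K : ℕ} (hK : 1 ≤ K) (ε : ℕ → Prop) (h : ∀ T, ∃ q, IsLayeredPattern M K ε T q) : False := by
  obtain ⟨n, hn, hfree⟩ := hM (2 * K + 1) (by omega) ℕ Set.univ (layerFormula ε (K + 1))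
    (layerFormula_isQF _ _)
  let I := {e : Fin n × Fin n // e.1 < e.2 ∧ (⊤ : SimpleGraph (Fin n)).Adj e.1 e.2}
  -- One leg index per pair of principal vertices; the extra one keeps the index `0`, used at the
  -- roots, in range.
  obtain ⟨q, hq⟩ := h (n * n + 1)
  let t : I → ℕ := fun e => (finProdFinEquiv e.1 : ℕ)
  have ht : ∀ e, t e < n * n + 1 := fun e => by
    have := (finProdFinEquiv e.1).2
    simp only [t]
    omega
  have htinj : ∀ e e', t e = t e' ↔ e = e' := fun e e' => by
    refine ⟨fun h => ?_, fun h => by rw [h]⟩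
    exact Subtype.ext (finProdFinEquiv.injective (Fin.ext h))
  let c : ℕ → Set V := fun l => {x | ∃ a i, i < n * n + 1 ∧ x = q a l i}
  have hc : ∀ a l i l', l ≤ K + 1 → l' ≤ K + 1 → i < n * n + 1 → (q a l i ∈ c l' ↔ l = l') := by
    intro a l i l' hl hl' hi
    constructor
    · rintro ⟨b, j, hj, h⟩
      by_contra hne
      exact hq.ne a b l l' i j hl hl' hi hj hne h
    · rintro rfl
      exact ⟨a, i, hi, rfl⟩
  let := unaryExpansion M c
  have hφ : ∀ a l i b l' j, l ≤ K + 1 → l' ≤ K + 1 → i < n * n + 1 → j < n * n + 1 →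
      ((layerFormula ε (K + 1)).Realize ![q a l i, q b l' j] ↔
        l' = l + 1 ∧ (a = b ∨ l = K) ∧ (i = j ∨ l = 0)) := by
    intro a l i b l' j hl hl' hi hj
    rw [realize_layerFormula]
    constructor
    · rintro ⟨k, hk, h1, h2, h3⟩
      rw [hc _ _ _ _ hl (by omega) hi] at h1
      rw [hc _ _ _ _ hl' (by omega) hj] at h2
      subst h1 h2
      exact ⟨rfl, (hq.adj_iff a b l i j (by omega) hi hj).1 h3⟩
    · rintro ⟨rfl, h⟩
      exact ⟨l, by omega, (hc _ _ _ _ hl (by omega) hi).2 rfl, (hc _ _ _ _ hl' hl' hj).2 rfl,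
        (hq.adj_iff a b l i j (by omega) hi hj).2 h⟩
  let cp : SubdivVertex (⊤ : SimpleGraph (Fin n)) (2 * K + 1) → ℕ := fun x => match x with
    | .inl a => a
    | .inr (e, i) => if (i : ℕ) ≤ K then e.1.1 else e.1.2
  let lv : SubdivVertex (⊤ : SimpleGraph (Fin n)) (2 * K + 1) → ℕ := fun x => match x with
    | .inl _ => 0
    | .inr (_, i) => if (i : ℕ) ≤ K then i + 1 else 2 * K + 1 - i
  let br : SubdivVertex (⊤ : SimpleGraph (Fin n)) (2 * K + 1) → ℕ := fun x => match x with
    | .inl _ => 0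
    | .inr (e, _) => t e
  have hlv : ∀ x, lv x ≤ K + 1 := by
    rintro (a | ⟨e, i⟩)
    · simp [lv]
    · simp only [lv]
      split_ifs <;> omega
  have hbr : ∀ x, br x < n * n + 1 := by
    rintro (a | ⟨e, i⟩)
    · simp [br]
    · exact ht e
  let F : SubdivVertex (⊤ : SimpleGraph (Fin n)) (2 * K + 1) → V := fun x => q (cp x) (lv x) (br x)
  have hinj : Function.Injective F := by
    intro x y hxy
    have hl : lv x = lv y := by
      by_contra hne
      exact hq.ne _ _ _ _ _ _ (hlv x) (hlv y) (hbr x) (hbr y) hne hxy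
    have hxy' : q (cp x) (lv x) (br x) = q (cp y) (lv x) (br y) := by
      have := hxy
      simp only [F] at this
      rwa [hl] at this ⊢
    have := hq.inj hK (hlv x) (hbr x) (hbr y) hxy'
    rcases x with a | ⟨e, i⟩ <;> rcases y with b | ⟨e', j⟩
    · simp only [lv, cp] at this
      congr 1
      ext
      omega
    · simp only [lv] at hl
      split_ifs at hl; omega
    · simp only [lv] at hl
      split_ifs at hl; omega
    · simp only [lv] at hl
      simp only [lv, cp, br, htinj] at this
      have he : e = e' := by
        rcases this.2 with h | h
        · exact h
        · split_ifs at h; omega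
      subst he
      have hlt := Fin.lt_def.1 e.2.1
      congr 2
      ext
      split_ifs at hl this <;> omega
  refine (hfree c trivial).false ⟨⟨F, hinj⟩, ?_⟩
  intro x y
  change (definedGraph M c (layerFormula ε (K + 1))).Adj (F x) (F y) ↔ _
  have e1 : (definedGraph M c (layerFormula ε (K + 1))).Adj (F x) (F y) ↔ F x ≠ F y ∧
      ((layerFormula ε (K + 1)).Realize ![F x, F y] ∨
        (layerFormula ε (K + 1)).Realize ![F y, F x]) := Iff.rfl
  rw [e1, hφ _ _ _ _ _ _ (hlv x) (hlv y) (hbr x) (hbr y),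
    hφ _ _ _ _ _ _ (hlv y) (hlv x) (hbr y) (hbr x), hinj.ne_iff, subdivision,
    SimpleGraph.fromRel_adj]
  refine and_congr_right fun hne => ?_
  rcases x with a | ⟨e, i⟩ <;> rcases y with b | ⟨e', j⟩
  · simp [lv]
  · have hlt := Fin.lt_def.1 e'.2.1
    simp only [lv, cp, br, Fin.ext_iff]
    split_ifs
    all_goals
      simp only [or_true, and_true, or_false, false_and]
      omega
  · have hlt := Fin.lt_def.1 e.2.1
    simp only [lv, cp, br, Fin.ext_iff]
    split_ifs
    all_goals
      simp only [or_true, and_true, or_false, false_or, false_and]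
      omega
  · simp only [lv, cp, br, htinj]
    by_cases he : e = e'
    · subst he
      have hlt := Fin.lt_def.1 e.2.1
      simp only [true_or, and_true, true_and]
      split_ifs <;> omega
    · have he' : e' ≠ e := fun h => he h.symm
      simp only [he, he', false_or, false_and]
      split_ifs
      all_goals
        simp only [and_false, false_or, or_false, iff_false]
        try omega

section Flips

variable {W : Type*} {G H : SimpleGraph W} {A S S' : Set W}

/-! ### Flips between classes -/

/-- Whether a pair of distinct vertices is flipped in `H` depends only on the `S`-classes of `G`
that contain them. -/
def IsClassFlip (G : SimpleGraph W) (S : Set W) (H : SimpleGraph W) : Prop :=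
  ∀ u u' v v', sameClass G S u u' → sameClass G S v v' → u ≠ v → u' ≠ v' →
    ((H.Adj u v ↔ G.Adj u v) ↔ (H.Adj u' v' ↔ G.Adj u' v'))

theorem finite_quotient_sameClass (G : SimpleGraph W) (hS : S.Finite) :
    Finite (Quotient (sameClass G S)) := by
  have : Finite S := hS
  have hlift : ∀ u v, sameClass G S u v →
      (({s : S | s.1 = u}, {s : S | G.Adj u s.1}) : Set S × Set S) =
        ({s : S | s.1 = v}, {s : S | G.Adj v s.1}) := by
    rintro u v (rfl | ⟨hu, hv, h⟩)
    · rfl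
    · congr 1
      · ext s
        exact iff_of_false (fun h : s.1 = u => hu (h ▸ s.2)) (fun h : s.1 = v => hv (h ▸ s.2))
      · ext s
        exact h s s.2
  refine Finite.of_injective (Quotient.lift _ hlift) ?_
  rintro ⟨u⟩ ⟨v⟩ huv
  obtain ⟨h1, h2⟩ := Prod.ext_iff.1 huv
  refine Quotient.sound ?_
  by_cases huS : u ∈ S
  · exact Or.inl ((Set.ext_iff.1 h1 ⟨u, huS⟩).1 rfl)
  · by_cases hvS : v ∈ S
    · exact Or.inl ((Set.ext_iff.1 h1 ⟨v, hvS⟩).2 rfl).symm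
    · exact Or.inr ⟨huS, hvS, fun s hs => Set.ext_iff.1 h2 ⟨s, hs⟩⟩

theorem atomicFlip_adj (G : SimpleGraph W) (A B : Set W) (u v : W) : (atomicFlip G A B).Adj u v ↔
    u ≠ v ∧ Xor (G.Adj u v) ((u ∈ A ∧ v ∈ B) ∨ (u ∈ B ∧ v ∈ A)) :=
  Iff.rfl

/-- There are finitely many classes, so it suffices to flip, once each, the unordered pairs of
classes on which `H` and `G` disagree. -/
theorem IsClassFlip.isSFlip (hH : IsClassFlip G S H) (hS : S.Finite) : IsSFlip S G H := by
  classical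
  have := finite_quotient_sameClass G hS
  let Q := Quotient (sameClass G S)
  let cl : W → Q := Quotient.mk _
  have hcl : ∀ q : Q, {x | cl x = q} ∈ (sameClass G S).classes := by
    rintro ⟨y⟩
    refine ⟨y, ?_⟩
    ext x
    exact Quotient.eq
  have key : ∀ F : Finset (Sym2 Q), ∃ l : List (Set W × Set W),
      (∀ p ∈ l, p.1 ∈ (sameClass G S).classes ∧ p.2 ∈ (sameClass G S).classes) ∧
      ∀ u v, (l.foldl (fun G' p => atomicFlip G' p.1 p.2) G).Adj u v ↔
        u ≠ v ∧ Xor (G.Adj u v) (s(cl u, cl v) ∈ F) := by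
    intro F
    induction F using Finset.induction_on with
    | empty =>
      refine ⟨[], by simp, fun u v => ?_⟩
      simp only [List.foldl_nil, Finset.notMem_empty, xor_def, not_false_eq_true, and_true,
        false_and, or_false]
      exact ⟨fun h => ⟨h.ne, h⟩, fun h => h.2⟩
    | insert e F he ih =>
      obtain ⟨l, hl, hl'⟩ := ih
      induction e using Sym2.ind with
      | _ a b =>
        refine ⟨l ++ [({x | cl x = a}, {x | cl x = b})], ?_, fun u v => ?_⟩
        · intro p hp
          rcases List.mem_append.1 hp with hp | hp
          · exact hl p hp
          · rw [List.mem_singleton.1 hp]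
            exact ⟨hcl a, hcl b⟩
        · rw [List.foldl_append]
          rw [List.foldl_cons, List.foldl_nil, atomicFlip_adj, hl', Finset.mem_insert]
          have h1 : s(cl u, cl v) = s(a, b) ↔
              (cl u = a ∧ cl v = b) ∨ (cl u = b ∧ cl v = a) := Sym2.eq_iff
          have h2 : s(cl u, cl v) = s(a, b) → s(cl u, cl v) ∉ F := fun h => h ▸ he
          simp only [Set.mem_ofPred_eq, ← h1, xor_def]
          tauto
  have hfin : {e : Sym2 Q | ∃ u v, u ≠ v ∧ e = s(cl u, cl v) ∧ ¬ (H.Adj u v ↔ G.Adj u v)}.Finite :=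
    Set.toFinite _
  obtain ⟨l, hl, hl'⟩ := key hfin.toFinset
  refine ⟨l, hl, ?_⟩
  ext u v
  rw [hl', Set.Finite.mem_toFinset]
  have : u ≠ v → (s(cl u, cl v) ∈ {e : Sym2 Q | ∃ u v, u ≠ v ∧ e = s(cl u, cl v) ∧
      ¬ (H.Adj u v ↔ G.Adj u v)} ↔ ¬ (H.Adj u v ↔ G.Adj u v)) := by
    intro hne
    refine ⟨?_, fun h => ⟨u, v, hne, rfl, h⟩⟩
    rintro ⟨u', v', hne', he, h⟩
    rcases Sym2.eq_iff.1 he with ⟨h1, h2⟩ | ⟨h1, h2⟩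
    · rwa [hH u u' v v' (Quotient.exact h1) (Quotient.exact h2) hne hne']
    · rwa [hH u v' v u' (Quotient.exact h1) (Quotient.exact h2) hne hne'.symm, H.adj_comm,
        G.adj_comm]
  by_cases hne : u = v
  · subst hne
    simp
  · rw [this hne, xor_def]
    tauto

theorem IsClassFlip.adj_iff_adj_iff (hH : IsClassFlip G S H) {u u' v v' : W}
    (hu : sameClass G S u u') (hv : sameClass G S v v') (h : u ≠ v) (h' : u' ≠ v') :
    (H.Adj u v ↔ H.Adj u' v') ↔ (G.Adj u v ↔ G.Adj u' v') := by
  have := hH u u' v v' hu hv h h'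
  tauto

theorem isClassFlip_self : IsClassFlip G S G := fun _ _ _ _ _ _ _ _ => by simp

/-- The graph obtained from `H` by complementing the adjacency of the pairs related by `F`. -/
def flipBy (H : SimpleGraph W) (F : W → W → Prop) (hF : ∀ u v, F u v → F v u) :
    SimpleGraph W where
  Adj u v := u ≠ v ∧ Xor (H.Adj u v) (F u v)
  symm := ⟨fun u v h => by
    refine ⟨h.1.symm, ?_⟩
    rw [H.adj_comm, iff_iff_eq.1 (⟨hF v u, hF u v⟩ : F v u ↔ F u v)]
    exact h.2⟩
  loopless := ⟨fun _ h => h.1 rfl⟩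

theorem IsClassFlip.flipBy (hH : IsClassFlip G S H) (hS : S ⊆ S') {F : W → W → Prop}
    (hF : ∀ u v, F u v → F v u)
    (hinv : ∀ u u' v v', sameClass G S' u u' → sameClass G S' v v' → F u v → F u' v') :
    IsClassFlip G S' (flipBy H F hF) := by
  intro u u' v v' hu hv hne hne'
  have h1 := hH u u' v v' (sameClass_mono hS hu) (sameClass_mono hS hv) hne hne'
  have h2 : F u v ↔ F u' v' := ⟨hinv u u' v v' hu hv,
    hinv u' u v' v ((sameClass G S').symm hu) ((sameClass G S').symm hv)⟩
  simp only [StableSep.flipBy, ne_eq, hne, hne', not_false_eq_true, true_and, xor_def]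
  tauto

/-! ### Balls -/

/-- The ball of radius `r` around `v`. -/
def ball (H : SimpleGraph W) (v : W) : ℕ → Set W
  | 0 => {v}
  | r + 1 => ball H v r ∪ {x | ∃ y ∈ ball H v r, H.Adj y x}

theorem ball_mono (H : SimpleGraph W) (v : W) {r s : ℕ} (h : r ≤ s) : ball H v r ⊆ ball H v s := by
  induction h with
  | refl => exact subset_rfl
  | step _ ih => exact ih.trans Set.subset_union_left

theorem mem_ball_length {v x : W} (p : H.Walk x v) : x ∈ ball H v p.length := by
  induction p with
  | nil => rfl
  | cons hadj q ih => exact Or.inr ⟨_, ih, hadj.symm⟩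

theorem lt_edist_of_notMem_ball {v x : W} {r : ℕ} (h : x ∉ ball H v r) :
    (r : ℕ∞) < H.edist v x := by
  by_contra hle
  rw [not_lt] at hle
  have hne : H.edist v x ≠ ⊤ := ne_top_of_le_ne_top (ENat.natCast_ne_top r) hle
  obtain ⟨p, hp⟩ := SimpleGraph.exists_walk_of_edist_ne_top hne
  rw [← hp, Nat.cast_le] at hle
  refine h (ball_mono H v hle ?_)
  rw [← p.length_reverse]
  exact mem_ball_length p.reverse

/-! ### Separation when the ball has finitely many traces -/

/-- The neighbours of `w` in `A`. -/
def trace (H : SimpleGraph W) (A : Set W) (w : W) : Set W := {m | m ∈ A ∧ H.Adj w m}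

theorem exists_flip_of_finite_traces (hst : HasStableEdgeRelation G)
    (hcl : ExistentiallyClosedIn G A) {v : W} {r : ℕ} (hS : S.Finite) (hSA : S ⊆ A)
    (hH : IsClassFlip G S H) (hball : ∀ x ∈ A, x ∉ ball H v r)
    (hfin : (trace H A '' ball H v r).Finite) :
    ∃ (S' : Set W) (H' : SimpleGraph W), S'.Finite ∧ S' ⊆ A ∧ IsClassFlip G S' H' ∧
      ∀ x ∈ A, x ∉ ball H' v (r + 1) := by
  have hBA : ∀ w ∈ ball H v r, w ∉ A := fun w hw hA => hball w hA hw
  have hBA' : ∀ w ∈ ball H v r, ∀ m ∈ A, w ≠ m := fun w hw m hm h => hball m hm (h ▸ hw)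
  obtain ⟨B₀, hB₀, hbij⟩ := Set.exists_subset_bijOn (ball H v r) (trace H A)
  have hB₀fin : B₀.Finite := by
    rw [← hbij.image_eq] at hfin
    exact hfin.of_finite_image hbij.injOn
  have hrep : ∀ w ∈ ball H v r, ∃ w₀ ∈ B₀, ∀ m ∈ A, (H.Adj w₀ m ↔ H.Adj w m) := by
    intro w hw
    obtain ⟨w₀, hw₀, h⟩ := hbij.surjOn ⟨w, hw, rfl⟩
    refine ⟨w₀, hw₀, fun m hm => ?_⟩
    have := Set.ext_iff.1 h m
    simpa [trace, hm] using this
  choose Sd hSdfin hSdA hSd using exists_definesTrace hst hcl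
  have hdist : ∀ w w' : W, ∃ D : Set W, D.Finite ∧ D ⊆ A ∧
      ((∀ m ∈ D, (H.Adj w m ↔ H.Adj w' m)) → ∀ m ∈ A, (H.Adj w m ↔ H.Adj w' m)) := by
    intro w w'
    by_cases h : ∀ m ∈ A, (H.Adj w m ↔ H.Adj w' m)
    · exact ⟨∅, Set.finite_empty, Set.empty_subset _, fun _ => h⟩
    · push Not at h
      obtain ⟨m, hm, hne⟩ := h
      refine ⟨{m}, Set.finite_singleton _, Set.singleton_subset_iff.2 hm, fun h' => ?_⟩
      have := h' m rfl
      tauto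
  choose D hDfin hDA hD using hdist
  -- For the finitely many representatives `B₀`, the set `S'` defines each trace and contains a
  -- witness for any two distinct ones.
  let S' : Set W := S ∪ ((⋃ w ∈ B₀, Sd w) ∪ ⋃ w ∈ B₀, ⋃ w' ∈ B₀, D w w')
  have hSS' : S ⊆ S' := Set.subset_union_left
  have hS'fin : S'.Finite := hS.union ((hB₀fin.biUnion fun w _ => hSdfin w).union
    (hB₀fin.biUnion fun w _ => hB₀fin.biUnion fun w' _ => hDfin w w'))
  have hS'A : S' ⊆ A := Set.union_subset hSA (Set.union_subset
    (Set.iUnion₂_subset fun w _ => hSdA w)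
    (Set.iUnion₂_subset fun w _ => Set.iUnion₂_subset fun w' _ => hDA w w'))
  have hdef : ∀ w ∈ ball H v r, DefinesTrace G A S' w := by
    intro w hw m hm m' hm' hmm
    obtain ⟨w₀, hw₀, h₀⟩ := hrep w hw
    have hmm' := sameClass_mono hSS' hmm
    have h1 : DefinesTrace G A S' w₀ := (hSd w₀).mono fun x hx =>
      Or.inr (Or.inl (Set.mem_biUnion hw₀ hx))
    rw [← hH.adj_iff_adj_iff ((sameClass G S).refl w) hmm' (hBA' w hw m hm) (hBA' w hw m' hm'),
      ← h₀ m hm, ← h₀ m' hm', hH.adj_iff_adj_iff ((sameClass G S).refl w₀) hmm'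
      (hBA' _ (hB₀ hw₀) m hm) (hBA' _ (hB₀ hw₀) m' hm')]
    exact h1 m hm m' hm' hmm
  have hdefH : ∀ w ∈ ball H v r, ∀ m ∈ A, ∀ m' ∈ A, sameClass G S' m m' →
      (H.Adj w m ↔ H.Adj w m') := by
    intro w hw m hm m' hm' hmm
    rw [hH.adj_iff_adj_iff ((sameClass G S).refl w) (sameClass_mono hSS' hmm)
      (hBA' w hw m hm) (hBA' w hw m' hm')]
    exact hdef w hw m hm m' hm' hmm
  have hsep : ∀ w ∈ ball H v r, ∀ w' ∈ ball H v r, sameClass G S' w w' →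
      ∀ m ∈ A, (H.Adj w m ↔ H.Adj w' m) := by
    intro w hw w' hw' hww m hm
    obtain ⟨w₀, hw₀, h₀⟩ := hrep w hw
    obtain ⟨w₁, hw₁, h₁⟩ := hrep w' hw'
    rw [← h₀ m hm, ← h₁ m hm]
    refine hD w₀ w₁ (fun d hd => ?_) m hm
    have hdA := hDA _ _ hd
    have hdS' : d ∈ S' :=
      Or.inr (Or.inr (Set.mem_biUnion hw₀ (Set.mem_biUnion hw₁ hd)))
    rw [h₀ d hdA, h₁ d hdA, hH.adj_iff_adj_iff (sameClass_mono hSS' hww) ((sameClass G S).refl d)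
      (hBA' w hw d hdA) (hBA' w' hw' d hdA)]
    rcases hww with rfl | ⟨-, -, h⟩
    · rfl
    · exact h d hdS'
  have hsymm : ∀ u ∈ ball H v r, ∀ w ∈ ball H v r, ∀ m ∈ A, ∀ m' ∈ A, sameClass G S' m u →
      sameClass G S' m' w → (H.Adj w m ↔ H.Adj u m') := by
    intro u hu w hw m hm m' hm' hmu hmw
    rw [H.adj_comm u, hH.adj_iff_adj_iff (sameClass_mono hSS' ((sameClass G S').symm hmw))
      (sameClass_mono hSS' hmu) (hBA' w hw m hm) (hBA' u hu m' hm').symm, G.adj_comm m']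
    exact adj_iff_of_definesTrace hst hcl hS'fin hS'A (hBA u hu) (hBA w hw) (hdef u hu)
      (hdef w hw) hm hm' hmu hmw
  have hcopy : ∀ w ∈ ball H v r, ∃ m ∈ A, sameClass G S' m w := by
    intro w hw
    obtain ⟨g, hgA, hfix, hinj, hadj⟩ := hcl (insert w S') (hS'fin.insert w)
    exact ⟨g w, hgA w (Or.inl rfl), sameClass_copy hS'A (Set.subset_insert _ _) hfix hinj hadj
      (Or.inl rfl) (hBA w hw)⟩
  let E : W → W → Prop := fun u x => ∃ w ∈ ball H v r, sameClass G S' w u ∧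
    ∃ m ∈ A, sameClass G S' m x ∧ H.Adj w m
  have hE : ∀ u u' x x', sameClass G S' u u' → sameClass G S' x x' → E u x → E u' x' := by
    rintro u u' x x' hu hx ⟨w, hw, hwu, m, hm, hmx, h⟩
    exact ⟨w, hw, (sameClass G S').trans hwu hu, m, hm, (sameClass G S').trans hmx hx, h⟩
  -- A flip is symmetric, so `E` must be symmetrized; by `hsymm` this adds no unwanted pair between
  -- the ball and `A`.
  let F : W → W → Prop := fun u x => E u x ∨ E x u
  have hF : ∀ u x, F u x → F x u := fun u x h => h.symm
  have hF1 : ∀ w ∈ ball H v r, ∀ m ∈ A, (F w m ↔ H.Adj w m) := by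
    intro w hw m hm
    constructor
    · rintro (⟨w', hw', hww, m', hm', hmm, h⟩ | ⟨w', hw', hwm, m', hm', hmw, h⟩)
      · rw [hsep w' hw' w hw hww m' hm'] at h
        exact (hdefH w hw m' hm' m hm hmm).1 h
      · exact (hsymm w hw w' hw' m' hm' m hm hmw ((sameClass G S').symm hwm)).1 h
    · intro h
      exact Or.inl ⟨w, hw, (sameClass G S').refl w, m, hm, (sameClass G S').refl m, h⟩
  -- If the class of `u` occurs on the `A` side of `E`, a copy in `A` of the ball vertex involved
  -- would, by symmetry, lie in the trace of `u`.
  have hF2 : ∀ u ∈ ball H v r, (∀ m ∈ A, ¬ H.Adj u m) → ∀ x, ¬ F u x := by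
    rintro u hu hno x (⟨w, hw, hwu, m, hm, -, h⟩ | ⟨w, hw, -, m, hm, hmu, h⟩)
    · exact hno m hm ((hsep w hw u hu hwu m hm).1 h)
    · obtain ⟨m', hm', hmw⟩ := hcopy w hw
      exact hno m' hm' ((hsymm u hu w hw m hm m' hm' hmu hmw).1 h)
  refine ⟨S', flipBy H F hF, hS'fin, hS'A, hH.flipBy hSS' hF ?_, ?_⟩
  · rintro u u' x x' hu hx (h | h)
    · exact Or.inl (hE u u' x x' hu hx h)
    · exact Or.inr (hE x x' u u' hx hu h)
  -- Vertices at distance less than `r` have empty trace, since the ball of radius `r` misses `A`;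
  -- by `hF2` their edges do not change.
  · have hsub : ∀ j ≤ r, ball (flipBy H F hF) v j ⊆ ball H v j := by
      intro j
      induction j with
      | zero => exact fun _ => subset_rfl
      | succ j ih =>
        rintro hj x (hx | ⟨y, hy, hyx⟩)
        · exact Or.inl (ih (by omega) hx)
        · have hy' := ih (by omega) hy
          have hnF : ¬ F y x := hF2 y (ball_mono H v (by omega) hy') (fun m hm h =>
            hball m hm (ball_mono H v hj (Or.inr ⟨y, hy', h⟩))) x
          have : Xor (H.Adj y x) (F y x) := hyx.2
          rw [xor_def] at this
          rcases this with h | h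
          · exact Or.inr ⟨y, hy', h.1⟩
          · exact (hnF h.1).elim
    rintro x hxA (hx | ⟨y, hy, hyx⟩)
    · exact hball x hxA (hsub r le_rfl hx)
    · have hy' := hsub r le_rfl hy
      have h1 : Xor (H.Adj y x) (F y x) := hyx.2
      have h2 := hF1 y hy' x hxA
      rw [xor_def] at h1
      rcases h1 with h | h
      · exact h.2 (h2.2 h.1)
      · exact h.2 (h2.1 h.1)

end Flips

section InfiniteTraces

variable {W : Type*} {G H : SimpleGraph W} {A S : Set W}

/-! ### Layered patterns when the ball has infinitely many traces -/

/-- If infinitely many traces on `A` are realized in `B`, then there is a sequence of vertices of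
`B`, with non-empty traces, and a sequence of vertices of `A` along which adjacency is the opposite
of what it is on the diagonal. -/
theorem exists_seq_of_infinite_traces {B : Set W} (hinf : (trace H A '' B).Infinite) :
    ∃ w m : ℕ → W, (∀ i, w i ∈ B ∧ m i ∈ A ∧ ∃ x ∈ A, H.Adj (w i) x) ∧
      ∀ i j, i < j → (H.Adj (w j) (m i) ↔ ¬ H.Adj (w i) (m i)) := by
  classical
  have : Infinite (trace H A '' B) := hinf.to_subtype
  let U : Ultrafilter (trace H A '' B) := Filter.hyperfilter _
  -- `T` is the limit trace. Each new `w` agrees with `T` on the earlier `m`, and its own `m` is a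
  -- point where its trace departs from `T`.
  let T : Set W := {m | ∀ᶠ x in (U : Filter (trace H A '' B)), m ∈ x.1}
  have hmaj : ∀ m, ∀ᶠ x in (U : Filter (trace H A '' B)), (m ∈ x.1 ↔ m ∈ T) := by
    intro m
    by_cases hm : m ∈ T
    · exact Filter.Eventually.mono (show ∀ᶠ x in _, _ from hm) fun x hx => iff_of_true hx hm
    · exact Filter.Eventually.mono (Ultrafilter.eventually_not.2 hm) fun x hx => iff_of_false hx hm
  have hne : ∀ Z : Set W, ∀ᶠ x in (U : Filter (trace H A '' B)), x.1 ≠ Z := by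
    intro Z
    have hfin : {x : trace H A '' B | x.1 = Z}.Finite :=
      Set.Subsingleton.finite fun x hx y hy => Subtype.ext (hx.trans hy.symm)
    exact Filter.compl_mem_hyperfilter_of_finite hfin
  have hAsub : ∀ x : trace H A '' B, x.1 ⊆ A := by
    rintro ⟨_, w, _, rfl⟩ m hm
    exact hm.1
  have hTA : T ⊆ A := by
    intro m hm
    obtain ⟨x, hx⟩ := Filter.Eventually.exists hm
    exact hAsub x hx
  obtain ⟨f, hf1, hf2⟩ := exists_seq_of_forall_finset_exists
    (fun t : W × W => (t.1 ∈ B ∧ t.2 ∈ A ∧ ∃ x ∈ A, H.Adj t.1 x) ∧ (H.Adj t.1 t.2 ↔ t.2 ∉ T))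
    (fun s t => H.Adj t.1 s.2 ↔ s.2 ∈ T) (by
      intro s hs
      have hall : ∀ᶠ x in (U : Filter (trace H A '' B)), ∀ y ∈ s, (y.2 ∈ x.1 ↔ y.2 ∈ T) := by
        rw [Filter.eventually_all_finset]
        exact fun y _ => hmaj y.2
      obtain ⟨⟨_, w, hw, rfl⟩, ⟨h1, h2⟩, h3⟩ := ((hall.and (hne T)).and (hne ∅)).exists
      obtain ⟨m, hm⟩ : ∃ m, ¬ (m ∈ trace H A w ↔ m ∈ T) := by
        by_contra h
        push Not at h
        exact h2 (Set.ext h)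
      have hmA : m ∈ A := by
        by_contra h
        exact hm (iff_of_false (fun h' => h h'.1) (fun h' => h (hTA h')))
      obtain ⟨x, hx⟩ := Set.nonempty_iff_ne_empty.2 h3
      have hadj : ∀ y ∈ A, (y ∈ trace H A w ↔ H.Adj w y) := fun y hy => by simp [trace, hy]
      refine ⟨(w, m), ⟨⟨hw, hmA, x, hx⟩, ?_⟩, fun y hy => ?_⟩
      · rw [hadj m hmA] at hm
        tauto
      · rw [← hadj _ (hs y hy).1.2.1]
        exact h1 y hy)
  refine ⟨fun i => (f i).1, fun i => (f i).2, fun i => (hf1 i).1, fun i j hij => ?_⟩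
  rw [hf2 i j hij, (hf1 i).2, not_not]

theorem exists_geodesic {v : W} {r : ℕ} {w : W} (hw : w ∈ ball H v r)
    (hw' : ∀ k < r, w ∉ ball H v k) :
    ∃ p : ℕ → W, p 0 = v ∧ p r = w ∧ (∀ l < r, H.Adj (p l) (p (l + 1))) ∧
      ∀ l ≤ r, p l ∈ ball H v l ∧ ∀ k < l, p l ∉ ball H v k := by
  induction r generalizing w with
  | zero => exact ⟨fun _ => w, hw, rfl, by omega, fun l hl => by
      obtain rfl : l = 0 := by omega
      exact ⟨hw, by omega⟩⟩
  | succ r ih =>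
    rcases hw with hw | ⟨y, hy, hyw⟩
    · exact (hw' r (by omega) hw).elim
    · obtain ⟨p, hp0, hpr, hadj, hlev⟩ := ih hy fun k hk hyk =>
        hw' (k + 1) (by omega) (Or.inr ⟨y, hyk, hyw⟩)
      refine ⟨fun l => if l ≤ r then p l else w, by simpa using hp0, by simp, ?_, ?_⟩
      · intro l hl
        by_cases hlr : l = r
        · subst hlr
          simpa [hpr] using hyw
        · have h1 : l ≤ r := by omega
          have h2 : l + 1 ≤ r := by omega
          simpa [h1, h2] using hadj l (by omega)
      · intro l hl
        by_cases hlr : l ≤ r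
        · simpa [hlr] using hlev l hlr
        · obtain rfl : l = r + 1 := by omega
          simp only [hlr, if_false]
          exact ⟨Or.inr ⟨y, hy, hyw⟩, hw'⟩

/-- Infinitely many geodesics `p i 0, …, p i r` of length `r` from `v`, prolonged by vertices
`p i (r + 1)` of `A`, on which classes and adjacency between consecutive levels are homogeneous. -/
structure IsSpider (G H : SimpleGraph W) (A S : Set W) (v : W) (r : ℕ) (p : ℕ → ℕ → W)
    (α ε : ℕ → Prop) : Prop where
  zero : ∀ i, p i 0 = v
  mem_ball : ∀ i, ∀ l ≤ r, p i l ∈ ball H v l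
  notMem_ball : ∀ i, ∀ l ≤ r, ∀ k < l, p i l ∉ ball H v k
  last_mem : ∀ i, p i (r + 1) ∈ A
  adj : ∀ i, ∀ l < r, H.Adj (p i l) (p i (l + 1))
  sameClass : ∀ i j, ∀ l ≤ r + 1, sameClass G S (p i l) (p j l)
  adj_of_ne : ∀ i j, ∀ l ≤ r, i ≠ j → (G.Adj (p i l) (p j (l + 1)) ↔ α l)
  adj_self : ∀ i, ∀ l ≤ r, (G.Adj (p i l) (p i (l + 1)) ↔ ε l)
  last_ne : ¬ (α r ↔ ε r)

/-- A ball vertex with non-empty trace is at distance exactly `r`, which supplies the geodesics.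
Ramsey's theorem makes classes and adjacencies homogeneous, and stability makes the adjacency
between different legs independent of their order. -/
theorem exists_isSpider (hst : HasStableEdgeRelation G) {v : W} {r : ℕ} (hS : S.Finite)
    (hH : IsClassFlip G S H) (hball : ∀ x ∈ A, x ∉ ball H v r)
    (hinf : (trace H A '' ball H v r).Infinite) :
    ∃ p α ε, IsSpider G H A S v r p α ε := by
  obtain ⟨w, m, hwm, hdiag⟩ := exists_seq_of_infinite_traces hinf
  have hgeo : ∀ i, ∃ p : ℕ → W, p 0 = v ∧ p r = w i ∧ (∀ l < r, H.Adj (p l) (p (l + 1))) ∧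
      ∀ l ≤ r, p l ∈ ball H v l ∧ ∀ k < l, p l ∉ ball H v k := by
    intro i
    refine exists_geodesic (hwm i).1 fun k hk hmem => ?_
    obtain ⟨x, hxA, hx⟩ := (hwm i).2.2
    exact hball x hxA (ball_mono H v hk (Or.inr ⟨_, hmem, hx⟩))
  choose p₀ hp0 hpr hpadj hplev using hgeo
  let p : ℕ → ℕ → W := fun i l => if l ≤ r then p₀ i l else m i
  have hp : ∀ i l, l ≤ r → p i l = p₀ i l := fun i l hl => by simp [p, hl]
  have hpm : ∀ i, p i (r + 1) = m i := fun i => by simp [p]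
  have := finite_quotient_sameClass G hS
  let c : ℕ → ℕ → (Fin (r + 2) → Quotient (sameClass G S)) × (Fin (r + 1) → Prop × Prop × Prop) :=
    fun i j => (fun l => Quotient.mk _ (p i l), fun l => (G.Adj (p i l) (p i (l + 1)),
      G.Adj (p i l) (p j (l + 1)), G.Adj (p j l) (p i (l + 1))))
  obtain ⟨g, ⟨cl, col⟩, hg, hc⟩ := exists_strictMono_homogeneous c
  have hcl : ∀ i (l : Fin (r + 2)), Quotient.mk (sameClass G S) (p (g i) l) = cl l := fun i l =>
    congrFun (Prod.ext_iff.1 (hc i (i + 1) (by omega))).1 l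
  have hcol : ∀ i j, i < j → ∀ l : Fin (r + 1), (G.Adj (p (g i) l) (p (g i) (l + 1)),
      G.Adj (p (g i) l) (p (g j) (l + 1)), G.Adj (p (g j) l) (p (g i) (l + 1))) = col l :=
    fun i j hij l => congrFun (Prod.ext_iff.1 (hc i j hij)).2 l
  let ε : ℕ → Prop := fun l => if h : l < r + 1 then (col ⟨l, h⟩).1 else True
  let α : ℕ → Prop := fun l => if h : l < r + 1 then (col ⟨l, h⟩).2.1 else True
  have hε : ∀ i, ∀ l ≤ r, (G.Adj (p (g i) l) (p (g i) (l + 1)) ↔ ε l) := by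
    intro i l hl
    have h : l < r + 1 := by omega
    simp only [ε, h, dif_pos, ← hcol i (i + 1) (by omega) ⟨l, h⟩]
  have hα : ∀ i j, i < j → ∀ l ≤ r, (G.Adj (p (g i) l) (p (g j) (l + 1)) ↔ α l) := by
    intro i j hij l hl
    have h : l < r + 1 := by omega
    simp only [α, h, dif_pos, ← hcol i j hij ⟨l, h⟩]
  have hα' : ∀ i j, i < j → ∀ l ≤ r, (G.Adj (p (g j) l) (p (g i) (l + 1)) ↔ α l) := by
    intro i j hij l hl
    have h : l < r + 1 := by omega
    have hβ : ∀ i j, i < j → (G.Adj (p (g j) l) (p (g i) (l + 1)) ↔ (col ⟨l, h⟩).2.2) := by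
      intro i j hij
      rw [← hcol i j hij ⟨l, h⟩]
    rw [hβ i j hij]
    exact (hst.symm_of_homogeneous (fun i => p (g i) l) (fun i => p (g i) (l + 1)) _ _
      (fun i j hij => hα i j hij l hl) hβ).symm
  have hclass : ∀ i j, ∀ l ≤ r + 1, sameClass G S (p (g i) l) (p (g j) l) := fun i j l hl =>
    Quotient.exact ((hcl i ⟨l, by omega⟩).trans (hcl j ⟨l, by omega⟩).symm)
  refine ⟨fun i => p (g i), α, ε, ?_, ?_, ?_, ?_, ?_, hclass, ?_, hε, ?_⟩
  · intro i
    rw [hp _ _ (by omega), hp0]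
  · intro i l hl
    rw [hp _ _ hl]
    exact (hplev _ l hl).1
  · intro i l hl
    rw [hp _ _ hl]
    exact (hplev _ l hl).2
  · intro i
    rw [hpm]
    exact (hwm _).2.1
  · intro i l hl
    rw [hp _ _ hl.le, hp _ _ hl]
    exact hpadj _ l hl
  · intro i j l hl hij
    rcases lt_or_gt_of_ne hij with h | h
    · exact hα i j h l hl
    · exact hα' j i h l hl
  · intro h
    have hne : ∀ i j, w i ≠ m j := fun i j h' => hball _ (hwm j).2.1 (h' ▸ (hwm i).1)
    have h1 := hα' 0 1 (by omega) r le_rfl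
    have h2 := hε 0 r le_rfl
    have h3 := hclass 1 0 r (by omega)
    rw [hp _ _ le_rfl, hpm, hpr] at h1 h2
    rw [hp _ _ le_rfl, hp _ _ le_rfl, hpr, hpr] at h3
    -- `hdiag` compares edges of `H` at two vertices of one `S`-class, so the comparison passes to
    -- `G`.
    have h4 := hH.adj_iff_adj_iff h3 ((sameClass G S).refl (m (g 0))) (hne _ _) (hne _ _)
    have h5 := hdiag _ _ (hg (show 0 < 1 by omega))
    tauto

/-! ### Copying a spider into `A` to form a layered pattern. -/

/-- Copies of a finite set `X` in `A` over `S`. -/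
structure IsCopy (G : SimpleGraph W) (A S X : Set W) (g : W → W) : Prop where
  mem : ∀ x ∈ X, g x ∈ A
  fix : ∀ x ∈ X, x ∈ A → g x = x
  inj : ∀ x ∈ X, ∀ x' ∈ X, g x = g x' → x = x'
  adj : ∀ x ∈ X, ∀ x' ∈ X, (G.Adj (g x) (g x') ↔ G.Adj x x')
  sameClass : ∀ x ∈ X, x ∉ A → sameClass G S (g x) x

/-- Earlier copies lie in `A`, so a new copy taken over them fixes them and sees them exactly as the
original does. -/
theorem exists_copies (hcl : ExistentiallyClosedIn G A) (hS : S.Finite) (hSA : S ⊆ A) {X : Set W}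
    (hX : X.Finite) :
    ∃ g : ℕ → W → W, (∀ a, IsCopy G A S X (g a)) ∧ ∀ a b, a < b → ∀ x ∈ X, ∀ x' ∈ X, x ∉ A →
      g b x ≠ g a x' ∧ (G.Adj (g b x) (g a x') ↔ G.Adj x (g a x')) := by
  classical
  refine exists_seq_of_forall_finset_exists (IsCopy G A S X) (fun g h => ∀ x ∈ X, ∀ x' ∈ X, x ∉ A →
    h x ≠ g x' ∧ (G.Adj (h x) (g x') ↔ G.Adj x (g x'))) fun s hs => ?_
  let Y : Set W := X ∪ (S ∪ ⋃ g ∈ s, g '' X)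
  have hY : Y.Finite := hX.union (hS.union (s.finite_toSet.biUnion fun g _ => hX.image g))
  have hXY : X ⊆ Y := Set.subset_union_left
  obtain ⟨h, hA, hfix, hinj, hadj⟩ := hcl Y hY
  refine ⟨h, ⟨fun x hx => hA x (hXY hx), fun x hx => hfix x (hXY hx),
    fun x hx x' hx' => hinj x (hXY hx) x' (hXY hx'), fun x hx x' hx' => hadj x (hXY hx) x' (hXY hx'),
    fun x hx hxA => sameClass_copy hSA (fun y hy => Or.inr (Or.inl hy)) hfix hinj hadj (hXY hx) hxA⟩,
    fun g hg x hx x' hx' hxA => ?_⟩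
  have hgY : g x' ∈ Y := Or.inr (Or.inr (Set.mem_biUnion hg ⟨x', hx', rfl⟩))
  have hgA : g x' ∈ A := (hs g hg).mem x' hx'
  have hgfix := hfix _ hgY hgA
  refine ⟨fun he => hxA ?_, ?_⟩
  · rw [hinj x (hXY hx) _ hgY (he.trans hgfix.symm)]
    exact hgA
  · rw [← hadj x (hXY hx) _ hgY, hgfix]

/-- The pattern starts at the last level where legs are not distinguished by adjacency. Inside a
copy it reproduces the spider; between copies only the feet, which lie in `A` and stay fixed, are
shared. -/
theorem IsSpider.exists_isLayeredPattern (hst : HasStableEdgeRelation G)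
    (hcl : ExistentiallyClosedIn G A) {v : W} {r : ℕ} (hS : S.Finite) (hSA : S ⊆ A)
    (hH : IsClassFlip G S H) (hball : ∀ x ∈ A, x ∉ ball H v r) {p : ℕ → ℕ → W} {α ε : ℕ → Prop}
    (hp : IsSpider G H A S v r p α ε) :
    ∃ K ε', 1 ≤ K ∧ ∀ T, ∃ q, IsLayeredPattern G K ε' T q ∧
      ∀ a l i, l ≤ K + 1 → i < T → q a l i ∈ A := by
  classical
  -- Level `0` qualifies because all legs start at `v`, and level `r` does not, by `last_ne`; `l₀`
  -- is the greatest that does.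
  obtain ⟨l₀, hl₀, hroot, hlegs⟩ : ∃ l₀ < r, (α l₀ ↔ ε l₀) ∧
      ∀ l, l₀ < l → l ≤ r → ¬ (α l ↔ ε l) := by
    have h0 : α 0 ↔ ε 0 := by
      rw [← hp.adj_of_ne 0 1 0 (by omega) (by omega), ← hp.adj_self 1 0 (by omega), hp.zero,
        hp.zero]
    have hspec := Nat.findGreatest_spec (P := fun l => α l ↔ ε l) (Nat.zero_le r) h0
    refine ⟨_, lt_of_le_of_ne (Nat.findGreatest_le r) (fun h => ?_), hspec,
      fun l hl hlr => Nat.findGreatest_is_greatest hl hlr⟩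
    rw [h] at hspec
    exact hp.last_ne hspec
  refine ⟨r - l₀, fun l => ε (l₀ + l), by omega, fun T => ?_⟩
  have hnA : ∀ i, ∀ l ≤ r, p i l ∉ A := fun i l hl hA =>
    hball _ hA (ball_mono H v hl (hp.mem_ball i l hl))
  let X : Set W := (fun t : ℕ × ℕ => p t.1 t.2) '' (Set.Iio (T + 1) ×ˢ Set.Iio (r + 2))
  have hXfin : X.Finite := ((Set.finite_Iio _).prod (Set.finite_Iio _)).image _
  have hpX : ∀ i l, i < T + 1 → l ≤ r + 1 → p i l ∈ X := fun i l hi hl =>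
    ⟨(i, l), ⟨hi, Nat.lt_succ_of_le hl⟩, rfl⟩
  choose Sd hSdfin hSdA hSd using exists_definesTrace hst hcl
  let S' : Set W := S ∪ ⋃ x ∈ X, Sd x
  have hS'fin : S'.Finite := hS.union (hXfin.biUnion fun x _ => hSdfin x)
  have hS'A : S' ⊆ A := Set.union_subset hSA (Set.iUnion₂_subset fun x _ => hSdA x)
  have hdef : ∀ x ∈ X, DefinesTrace G A S' x := fun x hx =>
    (hSd x).mono fun y hy => Or.inr (Set.mem_biUnion hx hy)
  obtain ⟨g, hg, hcross⟩ := exists_copies hcl hS'fin hS'A hXfin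
  -- The copy has the `S`-class of the next vertex on the leg, but an `H`-edge to it would put a
  -- vertex of `A` in the ball. Hence `G` takes the value opposite to the one along the leg.
  have hnonadj : ∀ a i j l, i < T + 1 → j < T + 1 → l < r →
      (G.Adj (p i l) (g a (p j (l + 1))) ↔ ¬ ε l) := by
    intro a i j l hi hj hl
    have hjX := hpX j (l + 1) hj (by omega)
    have hcls : StableSep.sameClass G S (g a (p j (l + 1))) (p i (l + 1)) :=
      (StableSep.sameClass G S).trans (sameClass_mono Set.subset_union_left
        ((hg a).sameClass _ hjX (hnA j _ hl))) (hp.sameClass j i (l + 1) (by omega))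
    have hgA := (hg a).mem _ hjX
    have h1 := hH.adj_iff_adj_iff ((StableSep.sameClass G S).refl (p i l)) hcls
      (fun h => hnA i l hl.le (h ▸ hgA)) (hp.adj i l hl).ne
    have h2 := hp.adj i l hl
    have h3 : ¬ H.Adj (p i l) (g a (p j (l + 1))) := fun h =>
      hball _ hgA (ball_mono H v hl (Or.inr ⟨_, hp.mem_ball i l hl.le, h⟩))
    have h4 := hp.adj_self i l hl.le
    tauto
  have hnonadj' : ∀ a i j l, i < T + 1 → j < T + 1 → l < r →
      (G.Adj (p j (l + 1)) (g a (p i l)) ↔ ¬ ε l) := by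
    intro a i j l hi hj hl
    have hiX := hpX i l hi (by omega)
    have hjX := hpX j (l + 1) hj (by omega)
    rw [← hnonadj a i j l hi hj hl]
    exact adj_iff_of_definesTrace hst hcl hS'fin hS'A (hnA i l hl.le) (hnA j _ hl) (hdef _ hiX)
      (hdef _ hjX) ((hg a).mem _ hiX) ((hg a).mem _ hjX) ((hg a).sameClass _ hiX (hnA i l hl.le))
      ((hg a).sameClass _ hjX (hnA j _ hl))
  have hacross : ∀ a b i j l, a ≠ b → i < T + 1 → j < T + 1 → l < r →
      (G.Adj (g a (p i l)) (g b (p j (l + 1))) ↔ ¬ ε l) := by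
    intro a b i j l hab hi hj hl
    have hiX := hpX i l hi (by omega)
    have hjX := hpX j (l + 1) hj (by omega)
    rcases lt_or_gt_of_ne hab with h | h
    · rw [G.adj_comm, (hcross a b h _ hjX _ hiX (hnA j _ hl)).2, hnonadj' a i j l hi hj hl]
    · rw [(hcross b a h _ hiX _ hjX (hnA i l hl.le)).2, hnonadj b i j l hi hj hl]
  have hlast : ∀ a b i, i < T + 1 → g a (p i (r + 1)) = g b (p i (r + 1)) := fun a b i hi => by
    rw [(hg a).fix _ (hpX i _ hi le_rfl) (hp.last_mem i),
      (hg b).fix _ (hpX i _ hi le_rfl) (hp.last_mem i)]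
  have hpne : ∀ i j l l', l < l' → l' ≤ r + 1 → p i l ≠ p j l' := by
    intro i j l l' hll hl' h
    rcases Nat.lt_or_ge r l' with hr | hr
    · obtain rfl : l' = r + 1 := by omega
      exact hnA i l (by omega) (h ▸ hp.last_mem j)
    · exact hp.notMem_ball j l' hr l hll (h ▸ hp.mem_ball i l (by omega))
  have hgne : ∀ a b i j l l', i < T + 1 → j < T + 1 → l < l' → l' ≤ r + 1 →
      g a (p i l) ≠ g b (p j l') := by
    intro a b i j l l' hi hj hll hl' h
    have hiX := hpX i l hi (by omega)
    have hjX := hpX j l' hj hl'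
    by_cases hab : a = b
    · subst hab
      exact hpne i j l l' hll hl' ((hg a).inj _ hiX _ hjX h)
    · rcases Nat.lt_or_ge r l' with hr | hr
      · obtain rfl : l' = r + 1 := by omega
        rw [hlast b a j hj] at h
        exact hpne i j l _ hll hl' ((hg a).inj _ hiX _ hjX h)
      · rcases lt_or_gt_of_ne hab with hlt | hlt
        · exact (hcross a b hlt _ hjX _ hiX (hnA j _ hr)).1 h.symm
        · exact (hcross b a hlt _ hiX _ hjX (hnA i _ (by omega))).1 h
  -- All legs share the root taken from leg `0`, which by `hroot` relates to every leg as to its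
  -- own.
  let br : ℕ → ℕ → ℕ := fun l i => if l = 0 then 0 else i
  have hbr : ∀ l i, i < T → br l i < T + 1 := fun l i hi => by
    simp only [br]
    split_ifs <;> omega
  refine ⟨fun a l i => g a (p (br l i) (l₀ + l)), ⟨?_, ?_⟩, ?_⟩
  · intro a b l i j hl hi hj
    have hi' := hbr l i hi
    have hj' := hbr (l + 1) j hj
    have hsucc : br (l + 1) j = j := by simp [br]
    have hsame : (G.Adj (g a (p (br l i) (l₀ + l))) (g a (p (br (l + 1) j) (l₀ + (l + 1)))) ↔
        ε (l₀ + l)) ↔ (i = j ∨ l = 0) := by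
      rw [(hg a).adj _ (hpX _ _ hi' (by omega)) _ (hpX _ _ hj' (by omega)), hsucc, ← add_assoc]
      by_cases hl0 : l = 0
      · subst hl0
        simp only [br, if_true, add_zero, or_true, iff_true]
        by_cases hj0 : j = 0
        · rw [hj0]
          exact hp.adj_self 0 l₀ (by omega)
        · rw [hp.adj_of_ne 0 j l₀ (by omega) (Ne.symm hj0)]
          exact hroot
      · simp only [br, hl0, if_false, or_false]
        by_cases hij : i = j
        · rw [hij]
          exact iff_of_true (hp.adj_self j _ (by omega)) rfl
        · rw [hp.adj_of_ne i j _ (by omega) hij]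
          exact iff_of_false (hlegs _ (by omega) (by omega)) hij
    by_cases hab : a = b
    · subst hab
      rw [hsame]
      simp
    · by_cases hlK : l = r - l₀
      · have : l₀ + (l + 1) = r + 1 := by omega
        rw [this] at hsame
        simp only [this]
        rw [hlast b a _ hj', hsame]
        simp [hlK]
      · rw [← add_assoc, hacross a b _ _ (l₀ + l) hab hi' hj' (by omega)]
        simp only [hab, hlK]
        tauto
  · intro a b l l' i j hl hl' hi hj hll
    rcases lt_or_gt_of_ne hll with h | h
    · exact hgne a b _ _ _ _ (hbr l i hi) (hbr l' j hj) (by omega) (by omega)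
    · exact (hgne b a _ _ _ _ (hbr l' j hj) (hbr l i hi) (by omega) (by omega)).symm
  · intro a l i hl hi
    exact (hg a).mem _ (hpX _ _ (hbr l i hi) (by omega))

end InfiniteTraces

/-! ### Descent of patterns to `M`, and the induction on the radius. -/

theorem IsLayeredPattern.of_embedding {V W : Type*} [Nonempty V] {M : SimpleGraph V}
    {N : SimpleGraph W} (f : M ↪g N) {K T : ℕ} {ε : ℕ → Prop} {q : ℕ → ℕ → ℕ → W}
    (hq : IsLayeredPattern N K ε T q)
    (hA : ∀ a l i, l ≤ K + 1 → i < T → q a l i ∈ Set.range f) :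
    IsLayeredPattern M K ε T fun a l i => Function.invFun f (q a l i) := by
  have hinv : ∀ a l i, l ≤ K + 1 → i < T → f (Function.invFun f (q a l i)) = q a l i :=
    fun a l i hl hi => Function.invFun_eq (hA a l i hl hi)
  constructor
  · intro a b l i j hl hi hj
    rw [← f.map_adj_iff, hinv _ _ _ (by omega) hi, hinv _ _ _ (by omega) hj]
    exact hq.adj_iff a b l i j hl hi hj
  · intro a b l l' i j hl hl' hi hj hll h
    refine hq.ne a b l l' i j hl hl' hi hj hll ?_
    rw [← hinv _ _ _ hl hi, ← hinv _ _ _ hl' hj, h]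

end StableSep

theorem theorem6p1 {V : Type u} (M : SimpleGraph V)
    (hpat : StableSep.PatternFree M) (hstab : StableSep.HasStableEdgeRelation M) (r : ℕ) :
    StableSep.RSeparable.{u, w} M r := by
  intro W N f v hv
  let := M.structure
  let := N.structure
  let e : M ↪g N := ⟨⟨f, f.injective⟩, fun {x y} => f.map_rel Language.adj ![x, y]⟩
  have hcl : StableSep.ExistentiallyClosedIn N (StableSep.vertexRange f) :=
    StableSep.existentiallyClosedIn_vertexRange f
  have hst : StableSep.HasStableEdgeRelation N := hstab.of_existentiallyClosedIn e hcl
  suffices h : ∃ (S : Set W) (H : SimpleGraph W), S.Finite ∧ S ⊆ StableSep.vertexRange f ∧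
      StableSep.IsClassFlip N S H ∧ ∀ x ∈ StableSep.vertexRange f, x ∉ StableSep.ball H v r by
    obtain ⟨S, H, hS, hSA, hH, hball⟩ := h
    refine ⟨S, hS, hSA, H, hH.isSFlip hS, ?_⟩
    rintro a rfl b hb
    exact StableSep.lt_edist_of_notMem_ball (hball b hb)
  induction r with
  | zero =>
    refine ⟨∅, N, Set.finite_empty, Set.empty_subset _, StableSep.isClassFlip_self, ?_⟩
    rintro x hx rfl
    exact hv hx
  | succ r ih =>
    obtain ⟨S, H, hS, hSA, hH, hball⟩ := ih
    by_cases hfin : (StableSep.trace H (StableSep.vertexRange f) '' StableSep.ball H v r).Finite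
    · exact StableSep.exists_flip_of_finite_traces hst hcl hS hSA hH hball hfin
    · exfalso
      obtain ⟨p, α, ε, hp⟩ := StableSep.exists_isSpider hst hS hH hball hfin
      obtain ⟨K, ε', hK, hpattern⟩ := hp.exists_isLayeredPattern hst hcl hS hSA hH hball
      obtain ⟨x, -⟩ := hp.last_mem 0
      have : Nonempty V := ⟨x⟩
      refine hpat.false_of_layeredPattern hK ε' fun T => ?_
      obtain ⟨q, hq, hqA⟩ := hpattern T
      exact ⟨_, hq.of_embedding e hqA⟩
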